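/- Fix integers $d\ge 1$ and $m\ge 0$. Let $\{h_\eta:\eta\in\Lambda\}$, with $\Lambda\subseteq\mathbb R^m$ open, be a family of probability densities on $\mathbb R$ with $\int x\,h_\eta(x)\,dx=0$ and $0<\int x^2h_\eta(x)\,dx<\infty$. For $k=1,\dots,d$ let $\{f^{(k)}_\theta:\theta\in\Theta_k\}$, with $\Theta_k\subseteq\mathbb R^k$ open, be families of probability densities on $\mathbb R$ which are nested: every member of the $k$-th family is a member of the $(k+1)$-st. Let $f_0$ be a density and let $\theta_0^{(k)}\in\Theta_k$ satisfy $f^{(k)}_{\theta_0^{(k)}}=f_0$ for every $k$. Put $g_k(y;(\theta,\eta))=\int_{\mathbb R} f^{(k)}_\theta(s)\,h_\eta(y-s)\,ds$, let $G_{k,(\theta,\eta)}$ be the distribution with density $g_k(\cdot\,;(\theta,\eta))$ and $G^n_{k,(\theta,\eta)}$ its $n$-fold product. The score is $$\dot l_{k,(\theta,\eta)}(y)=\frac{\nabla_{(\theta,\eta)}\,g_k(y;(\theta,\eta))}{g_k(y;(\theta,\eta))}\,1_{\{g_k(y;(\theta,\eta))>0\}}=(\dot l_\theta(y),\dot l_\eta(y)),$$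 and the Fisher information is $I_k(\theta,\eta)=\int \dot l\,\dot l^{\,T}\,dG_{k,(\theta,\eta)}$, with blocks $I_{11},I_{12},I_{21},I_{22}$. Assume that for every $k=1,\dots,d$ the problem is regular: (A1) for Lebesgue-almost every $y$, $g_k(y;\cdot)$ is continuously differentiable on $\Theta_k\times\Lambda$; (A2) $|\dot l_{k,(\theta,\eta)}|\in L_2(G_{k,(\theta,\eta)})$ for all $(\theta,\eta)\in\Theta_k\times\Lambda$; (A3) $I_k$ is nonsingular and continuous on $\Theta_k\times\Lambda$. Let $\eta_0\in\Lambda$. Let $l^{*(k)}=\dot l_\theta-I_{12}I_{22}^{-1}\dot l_\eta$, evaluated at $(\theta_0^{(k)},\eta_0)$, be the efficient score function for $\theta$ in the $k$-th model, and let $I^{*(k)}=\int l^{*(k)}\,l^{*(k)T}\,dG_{k,(\theta_0^{(k)},\eta_0)}$ be the efficient information matrix. Let $X_1,X_2,\dots$ be i.i.d. with density $f_0$ and $\varepsilon_1,\varepsilon_2,\dots$ i.i.d. with density $h_{\eta_0}$, all independent, and let $Y_j=X_j+\varepsilon_j$; write $P_{\theta_0,\eta_0}$ for the underlying probability. For each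 $k=1,\dots,d$ let $\hat l^{(k)}_{j}\in\mathbb R^k$ ($j\le n$) and $\hat L_k\in\mathbb R^{k\times k}$ be measurable functions of $Y_1,\dots,Y_n$ such that, as $n\to\infty$, $$\frac1{\sqrt n}\Bigl\|\sum_{j=1}^n\bigl(\hat l^{(k)}_{j}-l^{*(k)}(Y_j)\bigr)\Bigr\|\to0\quad\text{and}\quad \hat L_k\to (I^{*(k)})^{-1}\qquad\text{in } G^n_{k,(\theta_0^{(k)},\eta_0)}\text{-probability}.$$ Put $$W_k=\Bigl(\frac1{\sqrt n}\sum_{j=1}^n\hat l^{(k)}_{j}\Bigr)^{T}\hat L_k\,\Bigl(\frac1{\sqrt n}\sum_{j=1}^n\hat l^{(k)}_{j}\Bigr).$$ Let $\pi:\mathbb N\times\mathbb N\to\mathbb R$ satisfy $\pi(1,n)<\dots<\pi(d,n)$ for all $n\ge1$ and $\pi(j,n)-\pi(1,n)\to\infty$ as $n\to\infty$ for $j=2,\dots,d$, and let $$S=S(l^*)=\min\{k:1\le k\le d,\ W_k-\pi(k,n)\ge W_j-\pi(j,n)\ \text{for } j=1,\dots,d\}.$$ Then, as $n\to\infty$,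 $$P_{\theta_0,\eta_0}\bigl(S(l^*)>1\bigr)\to0\qquad\text{and}\qquad W_S\to_d\chi^2_1,$$ where $\chi^2_1$ is the chi-square distribution with one degree of freedom. -/

import Mathlib

open MeasureTheory ProbabilityTheory Filter Topology Set Matrix

noncomputable section

namespace Deconv

/-- `f` is a probability density on the real line with respect to Lebesgue measure. -/
structure IsDensity (f : ℝ → ℝ) : Prop where
  measurable : Measurable f
  nonneg : ∀ x, 0 ≤ f x
  integrable : Integrable f
  integral_eq_one : ∫ x, f x = 1

/-- The probability measure on the real line with Lebesgue density `f`. -/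
def lawOf (f : ℝ → ℝ) : Measure ℝ :=
  volume.withDensity (fun x => ENNReal.ofReal (f x))

/-- A `k`-dimensional parametric family `f_θ`, `θ ∈ Θ`, of densities of the signal `X`,
with open parameter set `Θ ⊆ ℝᵏ`. -/
structure SignalFamily (k : ℕ) where
  Θ : Set (Fin k → ℝ)
  f : (Fin k → ℝ) → ℝ → ℝ
  isOpen : IsOpen Θ
  isDensity : ∀ θ ∈ Θ, IsDensity (f θ)

/-- An `m`-dimensional parametric family `h_η`, `η ∈ Λ`, of densities of the error `ε`, with open
parameter set `Λ ⊆ ℝᵐ`; the error has mean zero and finite positive second moment. -/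
structure ErrorFamily (m : ℕ) where
  Λ : Set (Fin m → ℝ)
  h : (Fin m → ℝ) → ℝ → ℝ
  isOpen : IsOpen Λ
  isDensity : ∀ η ∈ Λ, IsDensity (h η)
  integrable_sq : ∀ η ∈ Λ, Integrable (fun x => x ^ 2 * h η x)
  second_moment_pos : ∀ η ∈ Λ, 0 < ∫ x, x ^ 2 * h η x
  mean_zero : ∀ η ∈ Λ, ∫ x, x * h η x = 0

section Model

variable {k m : ℕ} (F : SignalFamily k) (H : ErrorFamily m)

/-- The parameter set `Θ × Λ`. -/
def params : Set ((Fin k → ℝ) × (Fin m → ℝ)) := F.Θ ×ˢ H.Λ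

/-- The density `g(y; (θ, η)) = ∫ f_θ(s) h_η(y - s) ds` of an observation `Y = X + ε`. -/
def g (p : (Fin k → ℝ) × (Fin m → ℝ)) (y : ℝ) : ℝ :=
  ∫ s, F.f p.1 s * H.h p.2 (y - s)

/-- The law `G_{θ, η}` of one observation. -/
def G (p : (Fin k → ℝ) × (Fin m → ℝ)) : Measure ℝ := lawOf (g F H p)

/-- The law `Gⁿ_{θ, η}` of `n` independent observations. -/
def Gn (p : (Fin k → ℝ) × (Fin m → ℝ)) (n : ℕ) : Measure (Fin n → ℝ) :=
  Measure.pi (fun _ => G F H p)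

/-- The coordinate directions of the joint parameter `(θ, η)`. -/
def dir : Fin k ⊕ Fin m → (Fin k → ℝ) × (Fin m → ℝ)
  | Sum.inl i => (Pi.single i 1, 0)
  | Sum.inr i => (0, Pi.single i 1)

open Classical in
/-- The score function for `(θ, η)` at `p`: the gradient of `g(y; ·)` at `p`, divided by
`g(y; p)`, on the set where `g(y; p) > 0`, and zero elsewhere. -/
def score (p : (Fin k → ℝ) × (Fin m → ℝ)) (y : ℝ) (a : Fin k ⊕ Fin m) : ℝ :=
  if 0 < g F H p y then fderiv ℝ (fun q => g F H q y) p (dir a) / g F H p y else 0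

/-- The Fisher information matrix of the joint parameter `(θ, η)`. -/
def fisher (p : (Fin k → ℝ) × (Fin m → ℝ)) : Matrix (Fin k ⊕ Fin m) (Fin k ⊕ Fin m) ℝ :=
  Matrix.of fun a b => ∫ y, score F H p y a * score F H p y b ∂(G F H p)

/-- Regular deconvolution problem: the density is continuously differentiable in the parameter for
almost every `y`, the score is square integrable, and the Fisher information is nonsingular and
continuous. -/
structure IsRegular : Prop where
  contDiff : ∀ᵐ y : ℝ, ContDiffOn ℝ 1 (fun p => g F H p y) (params F H)
  memLp_score : ∀ p ∈ params F H,
    MemLp (fun y => WithLp.toLp 2 (score F H p y)) 2 (G F H p)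
  nonsingular : ∀ p ∈ params F H, IsUnit (fisher F H p).det
  continuous : ContinuousOn (fisher F H) (params F H)

/-- The efficient score function for `θ`: `l_θ - I₁₂ I₂₂⁻¹ l_η`. -/
def effScore (p : (Fin k → ℝ) × (Fin m → ℝ)) (y : ℝ) : Fin k → ℝ :=
  (fun i => score F H p y (Sum.inl i)) -
    ((fisher F H p).toBlocks₁₂ * (fisher F H p).toBlocks₂₂⁻¹) *ᵥ
      (fun j => score F H p y (Sum.inr j))

/-- The efficient Fisher information matrix for `θ`. -/
def effFisher (p : (Fin k → ℝ) × (Fin m → ℝ)) : Matrix (Fin k) (Fin k) ℝ :=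
  Matrix.of fun i j => ∫ y, effScore F H p y i * effScore F H p y j ∂(G F H p)

/-- Estimators `l*_1, …, l*_n` of the efficient scores at the observations, as functions of the
observations: they are sufficiently good at `p` if `n^{-1/2} ‖∑ⱼ (l*_j - l*(Y_j))‖` tends to zero in
`Gⁿ_p`-probability, with the Euclidean norm. -/
def SufficientlyGoodAt (p : (Fin k → ℝ) × (Fin m → ℝ))
    (l : (n : ℕ) → (Fin n → ℝ) → Fin n → Fin k → ℝ) : Prop :=
  ∀ r : ℝ, 0 < r → Tendsto
    (fun n : ℕ => Gn F H p n
      {y | r ≤ (1 / √(n : ℝ)) * ‖WithLp.toLp 2 (∑ j, (l n y j - effScore F H p (y j)))‖})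
    atTop (𝓝 0)

/-- The matrix estimator `L`, a function of the observations, is consistent at `p` for the inverse
of the efficient Fisher information. -/
def ConsistentAt (p : (Fin k → ℝ) × (Fin m → ℝ))
    (L : (n : ℕ) → (Fin n → ℝ) → Matrix (Fin k) (Fin k) ℝ) : Prop :=
  ∀ i j, ∀ r : ℝ, 0 < r → Tendsto
    (fun n : ℕ => Gn F H p n {y | r ≤ |L n y i j - (effFisher F H p)⁻¹ i j|})
    atTop (𝓝 0)

end Model

/-- The submodels of dimensions `1, …, d` are nested: every member of the `k`-th family is a member
of the `(k+1)`-st one. -/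
def IsNested (d : ℕ) (F : (k : ℕ) → SignalFamily k) : Prop :=
  ∀ k, 1 ≤ k → k < d → ∀ θ ∈ (F k).Θ, ∃ θ' ∈ (F (k + 1)).Θ, (F (k + 1)).f θ' = (F k).f θ

/-- The normalized sum `n^{-1/2} ∑ⱼ l_j`. -/
def normSum {k n : ℕ} (l : Fin n → Fin k → ℝ) : Fin k → ℝ :=
  (1 / √(n : ℝ)) • ∑ j, l j

/-- The efficient score test statistic: the quadratic form of `L` at the normalized sum of the
estimated efficient scores. -/
def scoreStat {k n : ℕ} (l : Fin n → Fin k → ℝ) (L : Matrix (Fin k) (Fin k) ℝ) : ℝ :=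
  normSum l ⬝ᵥ (L *ᵥ normSum l)

/-- A penalty for the models of dimensions `1, …, d`. -/
structure IsPenalty (d : ℕ) (pen : ℕ → ℕ → ℝ) : Prop where
  strictMono : ∀ n, 1 ≤ n → ∀ i j, 1 ≤ i → i < j → j ≤ d → pen i n < pen j n
  tendsto : ∀ j, 2 ≤ j → j ≤ d → Tendsto (fun n => pen j n - pen 1 n) atTop atTop

/-- The selection rule: the smallest `k` in `1, …, d` maximizing `W_k - π(k, n)`, where `w` and
`c` are the functions `k ↦ W_k` and `k ↦ π(k, n)`. -/
def selectionRule (d : ℕ) (w c : ℕ → ℝ) : ℕ :=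
  sInf {k | 1 ≤ k ∧ k ≤ d ∧ ∀ j, 1 ≤ j → j ≤ d → w j - c j ≤ w k - c k}

/-- The chi-square distribution with `k` degrees of freedom: the law of the sum of squares of `k`
independent standard normal variables. -/
def chiSquare (k : ℕ) : Measure ℝ :=
  (Measure.pi (fun _ : Fin k => gaussianReal 0 1)).map (fun z => ∑ i, z i ^ 2)

instance (k : ℕ) : IsProbabilityMeasure (chiSquare k) :=
  Measure.isProbabilityMeasure_map
    (Finset.measurable_sum _ fun i _ => (measurable_pi_apply i).pow_const 2).aemeasurable

end Deconv

end

/-!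
The score of a regular model is centred. Indeed `∫ g_p dy = 1` along any curve of parameters, and
continuity of the Fisher information `∫ (∂g)² / g` allows passing to the limit in `∫ ∂g` by
generalized dominated convergence with the dominating functions `((∂g)² / g + g) / 2`. Hence `∫ ∂g`
is continuous along the curve; its integral over any piece of the curve is a difference of total
masses, that is `0`, so it vanishes identically.

Consequently the efficient score is centred, with a covariance that is positive definite because
the Fisher information is. By the central limit theorem and Slutsky's lemma every `W_k` is
asymptotically tight, and `W_1` converges to `χ²₁`. Selecting a model `k > 1` forces `W_k - W_1` to
exceed the penalty gap `π(k, n) - π(1, n)`, which diverges, so `S = 1` with probability tending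
to `1` and `W_S` has the same limit as `W_1`.
-/

namespace Deconv

section DominatedConvergence

variable {ι α : Type*} [MeasurableSpace α] {μ : Measure α} {u : Filter ι}
  [u.IsCountablyGenerated] {f b : ι → α → ℝ} {f₀ b₀ : α → ℝ}

lemma tendsto_integral_posPart_sub (hb : ∀ i, Integrable (b i) μ) (hb₀ : Integrable b₀ μ)
    (hb_nonneg : ∀ i, ∀ᵐ x ∂μ, 0 ≤ b i x) (hb₀_nonneg : ∀ᵐ x ∂μ, 0 ≤ b₀ x)
    (hb_lsc : ∀ᵐ x ∂μ, ∀ c < b₀ x, ∀ᶠ i in u, c < b i x)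
    (hb_int : Tendsto (fun i => ∫ x, b i x ∂μ) u (𝓝 (∫ x, b₀ x ∂μ))) :
    Tendsto (fun i => ∫ x, (b i x - b₀ x)⁺ ∂μ) u (𝓝 0) := by
  have hneg : Tendsto (fun i => ∫ x, (b i x - b₀ x)⁻ ∂μ) u (𝓝 0) := by
    rw [← integral_zero α ℝ (μ := μ)]
    refine tendsto_integral_filter_of_dominated_convergence b₀
      (.of_forall fun i => ((hb i).sub hb₀).neg_part.aestronglyMeasurable)
      (.of_forall fun i => ?_) hb₀ ?_
    · filter_upwards [hb_nonneg i, hb₀_nonneg] with x hx hx₀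
      rw [Real.norm_of_nonneg (negPart_nonneg _)]
      exact sup_le (by linarith) hx₀
    · filter_upwards [hb_lsc] with x hx
      refine tendsto_order.2 ⟨fun c hc => .of_forall fun i => hc.trans_le (negPart_nonneg _),
        fun c hc => ?_⟩
      filter_upwards [hx (b₀ x - c) (by linarith)] with i hi
      exact max_lt (by linarith) hc
  have hsum : ∀ i, ∫ x, (b i x - b₀ x)⁺ ∂μ =
      (∫ x, b i x ∂μ - ∫ x, b₀ x ∂μ) + ∫ x, (b i x - b₀ x)⁻ ∂μ := fun i => calc
    _ = ∫ x, ((b i x - b₀ x) + (b i x - b₀ x)⁻) ∂μ := by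
      simp_rw [← sub_eq_iff_eq_add.1 (posPart_sub_negPart _)]
    _ = _ := by
      rw [← integral_sub (hb i) hb₀]
      exact integral_add ((hb i).sub hb₀) ((hb i).sub hb₀).neg_part
  simp_rw [hsum]
  simpa using (hb_int.sub_const (∫ x, b₀ x ∂μ)).add hneg

theorem tendsto_integral_of_tendsto_integral_bound
    (hf : ∀ i, AEStronglyMeasurable (f i) μ)
    (hb : ∀ i, Integrable (b i) μ) (hb₀ : Integrable b₀ μ)
    (hfb : ∀ i, ∀ᵐ x ∂μ, |f i x| ≤ b i x) (hfb₀ : ∀ᵐ x ∂μ, |f₀ x| ≤ b₀ x)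
    (hf_lim : ∀ᵐ x ∂μ, Tendsto (fun i => f i x) u (𝓝 (f₀ x)))
    (hb_lsc : ∀ᵐ x ∂μ, ∀ c < b₀ x, ∀ᶠ i in u, c < b i x)
    (hb_int : Tendsto (fun i => ∫ x, b i x ∂μ) u (𝓝 (∫ x, b₀ x ∂μ))) :
    Tendsto (fun i => ∫ x, f i x ∂μ) u (𝓝 (∫ x, f₀ x ∂μ)) := by
  have hexcess := tendsto_integral_posPart_sub hb hb₀
    (fun i => (hfb i).mono fun x => (abs_nonneg _).trans)
    (hfb₀.mono fun x => (abs_nonneg _).trans) hb_lsc hb_int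
  -- Truncating `f i` to `[-b₀, b₀]` makes it dominated and removes at most `(b i - b₀)⁺`.
  let φ i x := max (-b₀ x) (min (f i x) (b₀ x))
  have hφb : ∀ i, ∀ᵐ x ∂μ, ‖φ i x‖ ≤ b₀ x := fun i => by
    filter_upwards [hfb₀] with x hx
    have := (abs_nonneg _).trans hx
    exact abs_le.2 ⟨le_max_left _ _, max_le (by linarith) (min_le_right _ _)⟩
  have hφm : ∀ i, AEStronglyMeasurable (φ i) μ := fun i =>
    hb₀.aestronglyMeasurable.neg.sup ((hf i).inf hb₀.aestronglyMeasurable)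
  have hφ : Tendsto (fun i => ∫ x, φ i x ∂μ) u (𝓝 (∫ x, f₀ x ∂μ)) := by
    refine tendsto_integral_filter_of_dominated_convergence b₀ (.of_forall hφm)
      (.of_forall hφb) hb₀ ?_
    filter_upwards [hf_lim, hfb₀] with x hx hx₀
    obtain ⟨h1, h2⟩ := abs_le.1 hx₀
    simpa [φ, h1, h2] using (tendsto_const_nhds (x := -b₀ x)).max
      (hx.min (tendsto_const_nhds (x := b₀ x)))
  refine hφ.congr_dist (squeeze_zero (fun _ => dist_nonneg) (fun i => ?_) hexcess)
  have hfi : Integrable (f i) μ := (hb i).mono' (hf i) (hfb i)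
  have hφi : Integrable (φ i) μ := hb₀.mono' (hφm i) (hφb i)
  rw [dist_comm, dist_eq_norm, ← integral_sub hfi hφi]
  refine norm_integral_le_of_norm_le ((hb i).sub hb₀).pos_part ?_
  filter_upwards [hfb i] with x hx
  obtain ⟨h1, h2⟩ := abs_le.1 hx
  have := le_posPart (b i x - b₀ x)
  have := posPart_nonneg (b i x - b₀ x)
  rw [Real.norm_eq_abs, abs_le]
  simp only [φ]
  grind

end DominatedConvergence

theorem aemeasurable_uncurry_of_ae_continuous {T α E : Type*} [MeasurableSpace T]
    [TopologicalSpace T] [TopologicalSpace.MetrizableSpace T] [SecondCountableTopology T]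
    [OpensMeasurableSpace T] [MeasurableSpace α] [TopologicalSpace E]
    [TopologicalSpace.PseudoMetrizableSpace E] [MeasurableSpace E] [BorelSpace E] {μ : Measure α}
    {ν : Measure T} {D : T → α → E} (hD : ∀ t, AEMeasurable (D t) μ)
    (hDc : ∀ᵐ x ∂μ, Continuous fun t => D t x) :
    AEMeasurable (Function.uncurry D) (ν.prod μ) := by
  let τ : ℕ → SimpleFunc T T := (measurable_id (α := T)).stronglyMeasurable.approx
  have hτ : ∀ t, Tendsto (fun n => τ n t) atTop (𝓝 t) :=
    (measurable_id (α := T)).stronglyMeasurable.tendsto_approx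
  refine aemeasurable_of_tendsto_metrizable_ae' (f := fun n z => (hD (τ n z.1)).mk _ z.2)
    (fun n => ?_) ?_
  · have h : Measurable fun z : (τ n).range × α => (hD z.1).mk _ z.2 :=
      measurable_from_prod_countable_right fun t => (hD t).measurable_mk
    exact (h.comp ((((τ n).measurable.comp measurable_fst).subtype_mk
      (h := fun z => (τ n).mem_range_self z.1)).prodMk measurable_snd)).aemeasurable
  · have hmk : ∀ᵐ x ∂μ, ∀ n, ∀ t ∈ (τ n).range, D t x = (hD t).mk _ x :=
      ae_all_iff.2 fun n => (ae_ball_iff (τ n).range.countable_toSet).2 fun t _ => (hD t).ae_eq_mk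
    filter_upwards [Measure.quasiMeasurePreserving_snd.ae (hDc.and hmk)] with z hz
    exact ((hz.1.tendsto z.1).comp (hτ z.1)).congr fun n =>
      hz.2 n _ ((τ n).mem_range_self z.1)

lemma abs_le_sq_div_add {a b : ℝ} (hb : 0 ≤ b) (h : b = 0 → a = 0) :
    |a| ≤ (a ^ 2 / b + b) / 2 := by
  rcases hb.eq_or_lt with rfl | hb
  · simp [h rfl]
  · rw [← sq_abs]
    field_simp
    nlinarith [sq_nonneg (|a| - b)]

section Path

variable {α : Type*} [MeasurableSpace α] {μ : Measure α} {q : ℝ → α → ℝ}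

/-- A path `t ↦ q t` of nonnegative functions of constant integral, continuously differentiable in
`t` almost everywhere, with finite and continuous Fisher information
`t ↦ ∫ (∂q / ∂t)² / q ∂μ`. The junk value `x / 0 = 0` is harmless in the integrand: `∂q / ∂t`
vanishes where `q` does. -/
structure IsRegularPath (μ : Measure α) (q : ℝ → α → ℝ) : Prop where
  nonneg : ∀ᵐ x ∂μ, ∀ t, 0 ≤ q t x
  contDiff : ∀ᵐ x ∂μ, ContDiff ℝ 1 fun t => q t x
  integrable : ∀ t, Integrable (q t) μ
  integral_eq : ∀ s t, ∫ x, q s x ∂μ = ∫ x, q t x ∂μ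
  integrable_info : ∀ t, Integrable (fun x => deriv (fun s => q s x) t ^ 2 / q t x) μ
  continuous_info : Continuous fun t => ∫ x, deriv (fun s => q s x) t ^ 2 / q t x ∂μ

namespace IsRegularPath

lemma ae_hasDerivAt (h : IsRegularPath μ q) :
    ∀ᵐ x ∂μ, ∀ t, HasDerivAt (fun s => q s x) (deriv (fun s => q s x) t) t := by
  filter_upwards [h.contDiff] with x hx t
  exact (hx.differentiable one_ne_zero t).hasDerivAt

lemma ae_continuous_deriv (h : IsRegularPath μ q) :
    ∀ᵐ x ∂μ, Continuous fun t => deriv (fun s => q s x) t := by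
  filter_upwards [h.contDiff] with x hx using hx.continuous_deriv le_rfl

lemma ae_deriv_eq_zero (h : IsRegularPath μ q) :
    ∀ᵐ x ∂μ, ∀ t, q t x = 0 → deriv (fun s => q s x) t = 0 := by
  filter_upwards [h.nonneg] with x hx t ht
  exact IsLocalMin.deriv_eq_zero (.of_forall fun s => ht.trans_le (hx s))

lemma ae_abs_deriv_le (h : IsRegularPath μ q) :
    ∀ᵐ x ∂μ, ∀ t, |deriv (fun s => q s x) t| ≤
      (deriv (fun s => q s x) t ^ 2 / q t x + q t x) / 2 := by
  filter_upwards [h.nonneg, h.ae_deriv_eq_zero] with x hx h0 t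
  exact abs_le_sq_div_add (hx t) (h0 t)

lemma integrable_bound (h : IsRegularPath μ q) (t : ℝ) :
    Integrable (fun x => (deriv (fun s => q s x) t ^ 2 / q t x + q t x) / 2) μ :=
  ((h.integrable_info t).add (h.integrable t)).div_const 2

lemma continuous_integral_bound (h : IsRegularPath μ q) :
    Continuous fun t => ∫ x, (deriv (fun s => q s x) t ^ 2 / q t x + q t x) / 2 ∂μ := by
  have hmass : Continuous fun t => ∫ x, q t x ∂μ := by
    simp_rw [fun t => h.integral_eq t 0]
    exact continuous_const
  refine ((h.continuous_info.add hmass).div_const 2).congr fun t => ?_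
  rw [integral_div, integral_add (h.integrable_info t) (h.integrable t)]
  rfl

lemma aemeasurable_deriv (h : IsRegularPath μ q) (t : ℝ) :
    AEMeasurable (fun x => deriv (fun s => q s x) t) μ := by
  refine aemeasurable_of_tendsto_metrizable_ae (𝓝[≠] 0)
    (f := fun ε x => ε⁻¹ • (q (t + ε) x - q t x)) (fun ε => ?_) ?_
  · exact ((h.integrable _).aemeasurable.sub (h.integrable _).aemeasurable).const_smul ε⁻¹
  · filter_upwards [h.ae_hasDerivAt] with x hx
    exact (hx t).tendsto_slope_zero

lemma integrable_deriv (h : IsRegularPath μ q) (t : ℝ) :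
    Integrable (fun x => deriv (fun s => q s x) t) μ :=
  (h.integrable_bound t).mono' (h.aemeasurable_deriv t).aestronglyMeasurable
    (h.ae_abs_deriv_le.mono fun _ hx => hx t)

lemma ae_eventually_lt_bound (h : IsRegularPath μ q) (t : ℝ) :
    ∀ᵐ x ∂μ, ∀ c < (deriv (fun s => q s x) t ^ 2 / q t x + q t x) / 2,
      ∀ᶠ r in 𝓝 t, c < (deriv (fun s => q s x) r ^ 2 / q r x + q r x) / 2 := by
  filter_upwards [h.nonneg, h.contDiff, h.ae_continuous_deriv] with x hnn hx hx' c hc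
  rcases (hnn t).eq_or_lt with hq | hq
  · simp only [← hq, div_zero, add_zero, zero_div] at hc
    exact .of_forall fun r => hc.trans_le (by have := hnn r; positivity)
  · have hbound : ContinuousAt
        (fun r => (deriv (fun s => q s x) r ^ 2 / q r x + q r x) / 2) t := by
      have := hx.continuous.continuousAt (x := t)
      exact ((((hx'.continuousAt).pow 2).div this hq.ne').add this).div_const 2
    exact hbound.eventually_const_lt hc

lemma continuous_integral_deriv (h : IsRegularPath μ q) :
    Continuous fun t => ∫ x, deriv (fun s => q s x) t ∂μ :=
  continuous_iff_continuousAt.2 fun t => tendsto_integral_of_tendsto_integral_bound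
    (fun r => (h.aemeasurable_deriv r).aestronglyMeasurable) h.integrable_bound
    (h.integrable_bound t) (fun r => h.ae_abs_deriv_le.mono fun _ hx => hx r)
    (h.ae_abs_deriv_le.mono fun _ hx => hx t)
    (h.ae_continuous_deriv.mono fun _ hx => hx.tendsto t) (h.ae_eventually_lt_bound t)
    (h.continuous_integral_bound.tendsto t)

variable [SFinite μ]

lemma integrable_deriv_prod (h : IsRegularPath μ q) (a b : ℝ) :
    Integrable (Function.uncurry fun t x => deriv (fun s => q s x) t)
      ((volume.restrict (uIoc a b)).prod μ) := by
  have hm := (aemeasurable_uncurry_of_ae_continuous (ν := volume.restrict (uIoc a b))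
    h.aemeasurable_deriv h.ae_continuous_deriv).aestronglyMeasurable
  refine (integrable_prod_iff hm).2 ⟨ae_of_all _ h.integrable_deriv, ?_⟩
  refine (intervalIntegrable_iff.1 (h.continuous_integral_bound.intervalIntegrable a b)).mono'
    hm.norm.integral_prod_right' (ae_of_all _ fun t => ?_)
  rw [Real.norm_of_nonneg (integral_nonneg fun _ => norm_nonneg _)]
  exact integral_mono_ae (h.integrable_deriv t).norm (h.integrable_bound t)
    (h.ae_abs_deriv_le.mono fun _ hx => hx t)

lemma intervalIntegral_integral_deriv (h : IsRegularPath μ q) (a b : ℝ) :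
    ∫ t in a..b, ∫ x, deriv (fun s => q s x) t ∂μ = 0 := by
  have hFTC : ∀ᵐ x ∂μ, ∫ t in a..b, deriv (fun s => q s x) t = q b x - q a x := by
    filter_upwards [h.ae_hasDerivAt, h.ae_continuous_deriv] with x hd hc
    exact intervalIntegral.integral_eq_sub_of_hasDerivAt (fun t _ => hd t)
      (hc.intervalIntegrable a b)
  rw [intervalIntegral_integral_swap (h.integrable_deriv_prod a b), integral_congr_ae hFTC,
    integral_sub (h.integrable b) (h.integrable a), h.integral_eq b a, sub_self]

theorem integral_deriv (h : IsRegularPath μ q) (t : ℝ) :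
    ∫ x, deriv (fun s => q s x) t ∂μ = 0 := by
  have hprim : HasDerivAt (fun b => ∫ r in 0..b, ∫ x, deriv (fun s => q s x) r ∂μ)
      (∫ x, deriv (fun s => q s x) t ∂μ) t :=
    h.continuous_integral_deriv.integral_hasStrictDerivAt 0 t |>.hasDerivAt
  simp_rw [h.intervalIntegral_integral_deriv] at hprim
  exact hprim.unique (hasDerivAt_const t 0)

end IsRegularPath

end Path

section OpenFamily

variable {α E : Type*} [MeasurableSpace α] {μ : Measure α} [NormedAddCommGroup E]
  [NormedSpace ℝ E] {q : E → α → ℝ} {s : Set E} {x : E}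

/-- Bounding the displacement by a sine makes the curve a path in `s` over all of `ℝ`. -/
lemma exists_sin_curve_mem (hs : IsOpen s) (hx : x ∈ s) (v : E) :
    ∃ δ : ℝ, 0 < δ ∧ ∀ t : ℝ, x + (δ * Real.sin t) • v ∈ s := by
  have hmem : (fun r : ℝ => x + r • v) ⁻¹' s ∈ 𝓝 0 :=
    (hs.preimage (by fun_prop)).mem_nhds (by simpa using hx)
  obtain ⟨δ, hδ, hball⟩ := Metric.mem_nhds_iff.1 hmem
  refine ⟨δ / 2, half_pos hδ, fun t => hball ?_⟩
  rw [mem_ball_zero_iff, Real.norm_eq_abs, abs_mul, abs_of_pos (half_pos hδ)]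
  nlinarith [Real.abs_sin_le_one t]

theorem integral_fderiv_eq_zero_of_continuousOn_info [SFinite μ] (hs : IsOpen s) (hx : x ∈ s)
    (v : E) (hq_nonneg : ∀ᵐ y ∂μ, ∀ z ∈ s, 0 ≤ q z y)
    (hq_contDiff : ∀ᵐ y ∂μ, ContDiffOn ℝ 1 (fun z => q z y) s)
    (hq_integrable : ∀ z ∈ s, Integrable (q z) μ)
    (hq_integral : ∀ z ∈ s, ∀ w ∈ s, ∫ y, q z y ∂μ = ∫ y, q w y ∂μ)
    (hinfo_integrable : ∀ z ∈ s,
      Integrable (fun y => fderiv ℝ (fun w => q w y) z v ^ 2 / q z y) μ)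
    (hinfo_continuous : ContinuousOn
      (fun z => ∫ y, fderiv ℝ (fun w => q w y) z v ^ 2 / q z y ∂μ) s) :
    ∫ y, fderiv ℝ (fun z => q z y) x v ∂μ = 0 := by
  obtain ⟨δ, hδ, hγs⟩ := exists_sin_curve_mem hs hx v
  let γ : ℝ → E := fun t => x + (δ * Real.sin t) • v
  have hγ : ContDiff ℝ 1 γ := by fun_prop
  have hγ' : ∀ t, HasDerivAt γ ((δ * Real.cos t) • v) t := fun t =>
    (((Real.hasDerivAt_sin t).const_mul δ).smul_const v).const_add x
  have hderiv : ∀ᵐ y ∂μ, ∀ t, deriv (fun r => q (γ r) y) t =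
      (δ * Real.cos t) * fderiv ℝ (fun z => q z y) (γ t) v := by
    filter_upwards [hq_contDiff] with y hy t
    have hd := ((hy.differentiableOn one_ne_zero).differentiableAt
      (hs.mem_nhds (hγs t))).hasFDerivAt.comp_hasDerivAt t (hγ' t)
    simpa [Function.comp_def] using hd.deriv
  have hinfo : ∀ t, (fun y => deriv (fun r => q (γ r) y) t ^ 2 / q (γ t) y) =ᵐ[μ]
      fun y => (δ * Real.cos t) ^ 2 * (fderiv ℝ (fun w => q w y) (γ t) v ^ 2 / q (γ t) y) :=
    fun t => hderiv.mono fun y hy => by simp only [hy t, mul_pow, mul_div_assoc]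
  have hpath : IsRegularPath μ fun t => q (γ t) :=
    { nonneg := hq_nonneg.mono fun y hy t => hy _ (hγs t)
      contDiff := hq_contDiff.mono fun y hy => hy.comp_contDiff hγ hγs
      integrable := fun t => hq_integrable _ (hγs t)
      integral_eq := fun r t => hq_integral _ (hγs r) _ (hγs t)
      integrable_info := fun t => ((hinfo_integrable _ (hγs t)).const_mul _).congr (hinfo t).symm
      continuous_info := by
        simp_rw [fun t => integral_congr_ae (hinfo t), integral_const_mul]
        exact ((continuous_const.mul Real.continuous_cos).pow 2).mul
          (hinfo_continuous.comp_continuous hγ.continuous hγs) }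
  have hzero := hpath.integral_deriv 0
  rw [integral_congr_ae (hderiv.mono fun y hy => hy 0), integral_const_mul] at hzero
  simpa [γ, hδ.ne'] using hzero

end OpenFamily

section Density

open scoped Convolution

variable {f h : ℝ → ℝ}

namespace IsDensity

lemma isProbabilityMeasure_lawOf (hf : IsDensity f) : IsProbabilityMeasure (lawOf f) where
  measure_univ := by
    rw [lawOf, withDensity_apply _ MeasurableSet.univ, Measure.restrict_univ,
      ← ofReal_integral_eq_lintegral_ofReal hf.integrable (ae_of_all _ hf.nonneg),
      hf.integral_eq_one, ENNReal.ofReal_one]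

lemma integral_lawOf (hf : IsDensity f) (φ : ℝ → ℝ) :
    ∫ x, φ x ∂(lawOf f) = ∫ x, f x * φ x := by
  rw [lawOf, integral_withDensity_eq_integral_toReal_smul hf.measurable.ennreal_ofReal
    (ae_of_all _ fun _ => ENNReal.ofReal_lt_top)]
  simp only [ENNReal.toReal_ofReal (hf.nonneg _), smul_eq_mul]

lemma integrable_lawOf_iff (hf : IsDensity f) {φ : ℝ → ℝ} :
    Integrable φ (lawOf f) ↔ Integrable fun x => f x * φ x := by
  rw [lawOf, integrable_withDensity_iff_integrable_smul' hf.measurable.ennreal_ofReal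
    (ae_of_all _ fun _ => ENNReal.ofReal_lt_top)]
  simp only [ENNReal.toReal_ofReal (hf.nonneg _), smul_eq_mul]

lemma convolution (hf : IsDensity f) (hh : IsDensity h) :
    IsDensity (f ⋆[.mul ℝ ℝ] h) where
  measurable := by
    have : Measurable (Function.uncurry fun y s : ℝ => f s * h (y - s)) :=
      (hf.measurable.comp measurable_snd).mul
        (hh.measurable.comp (measurable_fst.sub measurable_snd))
    exact this.stronglyMeasurable.integral_prod_right.measurable
  nonneg y := integral_nonneg fun s => mul_nonneg (hf.nonneg s) (hh.nonneg (y - s))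
  integrable := hf.integrable.integrable_convolution _ hh.integrable
  integral_eq_one := by
    rw [integral_convolution _ hf.integrable hh.integrable, hf.integral_eq_one,
      hh.integral_eq_one, ContinuousLinearMap.mul_apply', mul_one]

lemma lawOf_conv_lawOf (hf : IsDensity f) (hh : IsDensity h) :
    lawOf f ∗ lawOf h = lawOf (f ⋆[.mul ℝ ℝ] h) := by
  have := hf.isProbabilityMeasure_lawOf
  have := hh.isProbabilityMeasure_lawOf
  rw [lawOf, lawOf, conv_withDensity_eq_lconvolution hf.measurable.ennreal_ofReal
    hh.measurable.ennreal_ofReal]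
  refine withDensity_congr_ae ?_
  filter_upwards [hf.integrable.ae_convolution_exists (.mul ℝ ℝ) hh.integrable] with y hy
  have hnonneg : ∀ s, 0 ≤ f s * h (y - s) := fun s => mul_nonneg (hf.nonneg s) (hh.nonneg _)
  simp only [lconvolution_def, ← ENNReal.ofReal_mul (hf.nonneg _), neg_add_eq_sub]
  exact (ofReal_integral_eq_lintegral_ofReal hy (ae_of_all _ hnonneg)).symm

end IsDensity

end Density

section SecondMoment

variable {α ι κ : Type*} [MeasurableSpace α] {μ : Measure α} [Fintype ι] {u : α → ι → ℝ}

/-- The matrix of second moments `∫ uₐ u_b ∂μ` of a random vector `u`, the common form of the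
Fisher information matrices `fisher` and `effFisher`. -/
noncomputable def secondMomentMatrix {ι : Type*} (μ : Measure α) (u : α → ι → ℝ) : Matrix ι ι ℝ :=
  Matrix.of fun a b => ∫ y, u y a * u y b ∂μ

lemma dotProduct_secondMomentMatrix_mulVec (hu : ∀ a, MemLp (fun y => u y a) 2 μ)
    (v w : ι → ℝ) :
    v ⬝ᵥ (secondMomentMatrix μ u *ᵥ w) = ∫ y, (v ⬝ᵥ u y) * (w ⬝ᵥ u y) ∂μ := by
  have hint : ∀ a b, Integrable (fun y => v a * u y a * (w b * u y b)) μ := fun a b =>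
    ((hu a).const_mul (v a)).integrable_mul ((hu b).const_mul (w b))
  simp only [dotProduct, Finset.sum_mul_sum]
  rw [integral_finsetSum _ fun a _ => integrable_finsetSum _ fun b _ => hint a b]
  refine Finset.sum_congr rfl fun a _ => ?_
  rw [integral_finsetSum _ fun b _ => hint a b, mulVec, dotProduct, Finset.mul_sum]
  refine Finset.sum_congr rfl fun b _ => ?_
  rw [secondMomentMatrix, of_apply, ← integral_mul_const, ← integral_const_mul]
  exact integral_congr_ae (ae_of_all _ fun y => by ring)

lemma posSemidef_secondMomentMatrix {ι : Type*} [Finite ι] {u : α → ι → ℝ}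
    (hu : ∀ a, MemLp (fun y => u y a) 2 μ) : (secondMomentMatrix μ u).PosSemidef := by
  have := Fintype.ofFinite ι
  refine .of_dotProduct_mulVec_nonneg (IsHermitian.ext fun a b => ?_) fun v => ?_
  · simp [secondMomentMatrix, mul_comm]
  · rw [star_trivial, dotProduct_secondMomentMatrix_mulVec hu]
    exact integral_nonneg fun y => mul_self_nonneg _

lemma secondMomentMatrix_mulVec (hu : ∀ a, MemLp (fun y => u y a) 2 μ) (A : Matrix κ ι ℝ) :
    secondMomentMatrix μ (fun y => A *ᵥ u y) = A * secondMomentMatrix μ u * Aᵀ := by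
  ext i j
  have hentry : (A * secondMomentMatrix μ u * Aᵀ) i j =
      A i ⬝ᵥ (secondMomentMatrix μ u *ᵥ A j) := by
    rw [Matrix.mul_assoc]
    rfl
  rw [hentry, dotProduct_secondMomentMatrix_mulVec hu]
  rfl

end SecondMoment

section Model

variable {k m : ℕ} {F : SignalFamily k} {H : ErrorFamily m}
  {p : (Fin k → ℝ) × (Fin m → ℝ)}

lemma isOpen_params : IsOpen (params F H) := F.isOpen.prod H.isOpen

lemma isDensity_g (hp : p ∈ params F H) : IsDensity (g F H p) :=
  (F.isDensity _ hp.1).convolution (H.isDensity _ hp.2)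

lemma isProbabilityMeasure_G (hp : p ∈ params F H) : IsProbabilityMeasure (G F H p) :=
  (isDensity_g hp).isProbabilityMeasure_lawOf

lemma hasLaw_add_G (hp : p ∈ params F H) {Ω : Type*} [MeasurableSpace Ω] {P : Measure Ω}
    {X ε : Ω → ℝ} (hX : HasLaw X (lawOf (F.f p.1)) P) (hε : HasLaw ε (lawOf (H.h p.2)) P)
    (hXε : IndepFun X ε P) :
    HasLaw (X + ε) (G F H p) P := by
  have := (F.isDensity _ hp.1).isProbabilityMeasure_lawOf
  have := (H.isDensity _ hp.2).isProbabilityMeasure_lawOf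
  have hlaw := hXε.hasLaw_add hX hε
  rwa [(F.isDensity _ hp.1).lawOf_conv_lawOf (H.isDensity _ hp.2)] at hlaw

lemma fderiv_g_eq_zero (hp : p ∈ params F H) {y : ℝ} (h : g F H p y = 0) :
    fderiv ℝ (fun q => g F H q y) p = 0 := by
  refine IsLocalMin.fderiv_eq_zero ?_
  filter_upwards [isOpen_params.mem_nhds hp] with q hq
  exact h.trans_le ((isDensity_g hq).nonneg y)

lemma g_mul_score (hp : p ∈ params F H) (y : ℝ) (a : Fin k ⊕ Fin m) :
    g F H p y * score F H p y a = fderiv ℝ (fun q => g F H q y) p (dir a) := by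
  rcases ((isDensity_g hp).nonneg y).eq_or_lt with h | h
  · simp [← h, fderiv_g_eq_zero hp h.symm]
  · rw [score, if_pos h, mul_div_cancel₀ _ h.ne']

lemma g_mul_score_mul_self (hp : p ∈ params F H) (y : ℝ) (a : Fin k ⊕ Fin m) :
    g F H p y * (score F H p y a * score F H p y a) =
      fderiv ℝ (fun q => g F H q y) p (dir a) ^ 2 / g F H p y := by
  rcases ((isDensity_g hp).nonneg y).eq_or_lt with h | h
  · simp [← h]
  · rw [score, if_pos h]
    field_simp

lemma IsRegular.memLp_score_apply (h : IsRegular F H) (hp : p ∈ params F H)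
    (a : Fin k ⊕ Fin m) : MemLp (fun y => score F H p y a) 2 (G F H p) :=
  (h.memLp_score p hp).eval_piLp a

theorem IsRegular.integral_score (h : IsRegular F H) (hp : p ∈ params F H)
    (a : Fin k ⊕ Fin m) : ∫ y, score F H p y a ∂(G F H p) = 0 := by
  have hinfo : ∀ z ∈ params F H,
      ∫ y, fderiv ℝ (fun q => g F H q y) z (dir a) ^ 2 / g F H z y = fisher F H z a a := by
    intro z hz
    simp_rw [← g_mul_score_mul_self hz]
    exact ((isDensity_g hz).integral_lawOf _).symm
  rw [G, (isDensity_g hp).integral_lawOf]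
  simp_rw [g_mul_score hp]
  refine integral_fderiv_eq_zero_of_continuousOn_info isOpen_params hp (dir a)
    (ae_of_all _ fun y z hz => (isDensity_g hz).nonneg y) h.contDiff
    (fun z hz => (isDensity_g hz).integrable)
    (fun z hz w hw => by rw [(isDensity_g hz).integral_eq_one, (isDensity_g hw).integral_eq_one])
    (fun z hz => ?_) ?_
  · simp_rw [← g_mul_score_mul_self hz]
    exact (isDensity_g hz).integrable_lawOf_iff.1
      ((h.memLp_score_apply hz a).integrable_mul (h.memLp_score_apply hz a))
  · exact ((continuous_id.matrix_elem a a).comp_continuousOn h.continuous).congr hinfo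

lemma IsRegular.posDef_fisher (h : IsRegular F H) (hp : p ∈ params F H) :
    (fisher F H p).PosDef :=
  (posSemidef_secondMomentMatrix (h.memLp_score_apply hp)).posDef_iff_isUnit.2
    ((isUnit_iff_isUnit_det _).2 (h.nonsingular p hp))

/-- The matrix `(1, -I₁₂ I₂₂⁻¹)` that turns the score into the efficient score. -/
noncomputable def effCoeff (F : SignalFamily k) (H : ErrorFamily m)
    (p : (Fin k → ℝ) × (Fin m → ℝ)) : Matrix (Fin k) (Fin k ⊕ Fin m) ℝ :=
  fromCols 1 (-((fisher F H p).toBlocks₁₂ * (fisher F H p).toBlocks₂₂⁻¹))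

lemma effScore_eq_mulVec (p : (Fin k → ℝ) × (Fin m → ℝ)) (y : ℝ) :
    effScore F H p y = effCoeff F H p *ᵥ score F H p y := by
  rw [effCoeff, fromCols_mulVec, one_mulVec, neg_mulVec, ← sub_eq_add_neg]
  rfl

lemma effScore_apply_eq_sum (p : (Fin k → ℝ) × (Fin m → ℝ)) (y : ℝ) (i : Fin k) :
    effScore F H p y i = ∑ a, effCoeff F H p i a * score F H p y a := by
  rw [effScore_eq_mulVec, mulVec, dotProduct]

lemma IsRegular.memLp_effScore (h : IsRegular F H) (hp : p ∈ params F H) (i : Fin k) :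
    MemLp (fun y => effScore F H p y i) 2 (G F H p) := by
  simp_rw [effScore_apply_eq_sum]
  exact memLp_finsetSum _ fun a _ => (h.memLp_score_apply hp a).const_mul _

lemma IsRegular.integral_effScore (h : IsRegular F H) (hp : p ∈ params F H) (i : Fin k) :
    ∫ y, effScore F H p y i ∂(G F H p) = 0 := by
  have := isProbabilityMeasure_G hp
  simp_rw [effScore_apply_eq_sum]
  rw [integral_finsetSum _ fun a _ =>
    ((h.memLp_score_apply hp a).integrable one_le_two).const_mul _]
  simp [integral_const_mul, h.integral_score hp]

lemma IsRegular.posDef_effFisher (h : IsRegular F H) (hp : p ∈ params F H) :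
    (effFisher F H p).PosDef := by
  have heff : effFisher F H p = effCoeff F H p * fisher F H p * (effCoeff F H p)ᴴ := by
    rw [conjTranspose_eq_transpose_of_trivial]
    refine Eq.trans ?_ (secondMomentMatrix_mulVec (h.memLp_score_apply hp) (effCoeff F H p))
    simp_rw [← effScore_eq_mulVec]
    rfl
  rw [heff]
  refine (h.posDef_fisher hp).mul_mul_conjTranspose_same fun v w hvw => ?_
  simp only [effCoeff, vecMul_fromCols, vecMul_one] at hvw
  exact funext fun i => congrFun hvw (Sum.inl i)

end Model

section Tightness

open scoped ENNReal

variable {ι Ω E E' : Type*} [MeasurableSpace Ω] {P : Measure Ω} {u : Filter ι}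
  [TopologicalSpace E] [TopologicalSpace E'] {f : ι → Ω → E} {f' : ι → Ω → E'}

/-- Asymptotic tightness (boundedness in probability) of random elements `f i` along the filter
`u`: up to an event of small probability, `f i` eventually stays in a fixed compact set. -/
def AsymptoticallyTight (P : Measure Ω) (u : Filter ι) (f : ι → Ω → E) : Prop :=
  ∀ δ : ℝ≥0∞, 0 < δ → ∃ K, IsCompact K ∧ ∀ᶠ i in u, P {ω | f i ω ∉ K} ≤ δ

namespace AsymptoticallyTight

lemma continuous_comp (hf : AsymptoticallyTight P u f) {φ : E → E'} (hφ : Continuous φ) :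
    AsymptoticallyTight P u fun i ω => φ (f i ω) := by
  intro δ hδ
  obtain ⟨K, hK, hfK⟩ := hf δ hδ
  refine ⟨φ '' K, hK.image hφ, hfK.mono fun i hi => (measure_mono fun ω hω => ?_).trans hi⟩
  exact fun hmem => hω (mem_image_of_mem φ hmem)

lemma pi {α : Type*} [Finite α] {E : α → Type*} [∀ a, TopologicalSpace (E a)]
    {f : (a : α) → ι → Ω → E a} (hf : ∀ a, AsymptoticallyTight P u (f a)) :
    AsymptoticallyTight P u fun i ω a => f a i ω := by
  intro δ hδ
  obtain ⟨δ', hδ'_pos, hδ'_sum⟩ := ENNReal.exists_pos_sum_of_countable' hδ.ne' α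
  choose K hK hfK using fun a => hf a (δ' a) (hδ'_pos a)
  refine ⟨univ.pi K, isCompact_univ_pi hK, (eventually_all.2 hfK).mono fun i hi => ?_⟩
  calc P {ω | (fun a => f a i ω) ∉ univ.pi K}
      ≤ P (⋃ a, {ω | f a i ω ∉ K a}) := measure_mono fun ω hω => by simpa using hω
    _ ≤ ∑' a, P {ω | f a i ω ∉ K a} := measure_iUnion_le _
    _ ≤ ∑' a, δ' a := ENNReal.tsum_le_tsum hi
    _ ≤ δ := hδ'_sum.le

lemma prodMk (hf : AsymptoticallyTight P u f) (hf' : AsymptoticallyTight P u f') :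
    AsymptoticallyTight P u fun i ω => (f i ω, f' i ω) := by
  intro δ hδ
  obtain ⟨K, hK, hfK⟩ := hf (δ / 2) (ENNReal.half_pos hδ.ne')
  obtain ⟨K', hK', hfK'⟩ := hf' (δ / 2) (ENNReal.half_pos hδ.ne')
  refine ⟨K ×ˢ K', hK.prod hK', ?_⟩
  filter_upwards [hfK, hfK'] with i hi hi'
  calc P {ω | (f i ω, f' i ω) ∉ K ×ˢ K'}
      ≤ P ({ω | f i ω ∉ K} ∪ {ω | f' i ω ∉ K'}) :=
        measure_mono fun ω hω => by
          by_contra hcon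
          simp only [mem_union, mem_ofPred_eq, not_or, not_not] at hcon
          exact hω hcon
    _ ≤ δ / 2 + δ / 2 := (measure_union_le _ _).trans (add_le_add hi hi')
    _ = δ := ENNReal.add_halves δ

lemma of_tendstoInDistribution [TopologicalSpace.IsCompletelyPseudoMetrizableSpace E]
    [SecondCountableTopology E] [WeaklyLocallyCompactSpace E] [MeasurableSpace E] [BorelSpace E]
    [HasOuterApproxClosed E] [IsProbabilityMeasure P] {Ω' : Type*} [MeasurableSpace Ω']
    {Q : Measure Ω'} [IsProbabilityMeasure Q] {Z : Ω' → E}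
    (h : TendstoInDistribution f u Z (fun _ => P) Q) : AsymptoticallyTight P u f := by
  intro δ hδ
  obtain ⟨δ', hδ'_pos, hδ'⟩ := exists_between hδ
  obtain ⟨K, hK, hZK⟩ := isTightMeasureSet_iff_exists_isCompact_measure_compl_le.1
    (isTightMeasureSet_singleton (μ := Q.map Z)) δ' hδ'_pos
  obtain ⟨K', hK', hKK'⟩ := exists_compact_superset hK
  refine ⟨K', hK', ?_⟩
  have hlimsup := ProbabilityMeasure.limsup_measure_closed_le_of_tendsto h.tendsto
    (isOpen_interior (s := K')).isClosed_compl
  have hZK' : Q.map Z (interior K')ᶜ ≤ δ' :=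
    (measure_mono (compl_subset_compl.2 hKK')).trans (hZK _ rfl)
  filter_upwards [eventually_lt_of_limsup_lt ((hlimsup.trans hZK').trans_lt hδ')] with i hi
  refine le_trans ?_ hi.le
  refine le_trans ?_ (Measure.le_map_apply (h.forall_aemeasurable i) _)
  exact measure_mono fun ω hω hmem => hω (interior_subset hmem)

lemma tendsto_measure_ge {R : Type*} [LinearOrder R] [NoMaxOrder R] [Nonempty R]
    [TopologicalSpace R] [OrderClosedTopology R] {f : ι → Ω → R} {a : ι → R}
    (hf : AsymptoticallyTight P u f) (ha : Tendsto a u atTop) :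
    Tendsto (fun i => P {ω | a i ≤ f i ω}) u (𝓝 0) := by
  refine ENNReal.tendsto_nhds_zero.2 fun δ hδ => ?_
  obtain ⟨K, hK, hfK⟩ := hf δ hδ
  obtain ⟨C, hC⟩ := hK.bddAbove
  filter_upwards [hfK, ha.eventually_gt_atTop C] with i hi hai
  refine (measure_mono fun ω hω hmem => ?_).trans hi
  exact (hai.trans_le hω).not_ge (hC hmem)

end AsymptoticallyTight

end Tightness

section Distribution

variable {ι Ω Ω' E : Type*} [MeasurableSpace Ω] [MeasurableSpace Ω'] {P : Measure Ω}
  [IsProbabilityMeasure P] {Q : Measure Ω'} [IsProbabilityMeasure Q] {u : Filter ι}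
  [MeasurableSpace E] {V V' : ι → Ω → E} {Z : Ω' → E}

lemma tendstoInDistribution_id_of_hasLaw [TopologicalSpace E] [OpensMeasurableSpace E]
    {ν : Measure E} [IsProbabilityMeasure ν] (h : TendstoInDistribution V u Z (fun _ => P) Q)
    (hZ : HasLaw Z ν Q) : TendstoInDistribution V u id (fun _ => P) ν where
  forall_aemeasurable := h.forall_aemeasurable
  aemeasurable_limit := aemeasurable_id
  tendsto := by
    convert h.tendsto using 2
    exact congrArg 𝓝 (Subtype.ext (Measure.map_id.trans hZ.map_eq.symm))

lemma tendstoInDistribution_of_tendsto_measure_ne [SeminormedAddCommGroup E]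
    [SecondCountableTopology E] [BorelSpace E] [u.IsCountablyGenerated]
    (h : TendstoInDistribution V u Z (fun _ => P) Q) (hV' : ∀ i, AEMeasurable (V' i) P)
    (hne : Tendsto (fun i => P {ω | V' i ω ≠ V i ω}) u (𝓝 0)) :
    TendstoInDistribution V' u Z (fun _ => P) Q := by
  refine tendstoInDistribution_of_tendstoInMeasure_sub V' Z h ?_ hV'
  refine tendstoInMeasure_iff_norm.2 fun r hr => ?_
  refine tendsto_of_tendsto_of_tendsto_of_le_of_le tendsto_const_nhds hne
    (fun i => zero_le) fun i => measure_mono fun ω hω heq => hr.not_ge ?_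
  simpa [heq] using hω

end Distribution

section Sample

variable {Ω : Type*} [MeasurableSpace Ω] {P : Measure Ω} {Y : ℕ → Ω → ℝ} {ν : Measure ℝ}

lemma measure_preimage_le_of_hasLaw {α : Type*} [MeasurableSpace α] {μ : Measure α} {V : Ω → α}
    (hV : HasLaw V μ P) (s : Set α) : P (V ⁻¹' s) ≤ μ s :=
  (Measure.le_map_apply hV.aemeasurable s).trans_eq (by rw [hV.map_eq])

lemma hasLaw_sample (hY : ∀ i, HasLaw (Y i) ν P) (hind : iIndepFun Y P) (n : ℕ) :
    HasLaw (fun ω (j : Fin n) => Y j ω) (Measure.pi fun _ => ν) P :=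
  (hind.precomp (g := ((↑) : Fin n → ℕ)) Fin.val_injective).hasLaw_pi fun j => hY j

lemma tendstoInDistribution_sum_div_sqrt [IsProbabilityMeasure P] {Ω' : Type*}
    [MeasurableSpace Ω'] {Q : Measure Ω'} [IsProbabilityMeasure Q] {Z : Ω' → ℝ} {ψ : ℝ → ℝ}
    (hY : ∀ i, HasLaw (Y i) ν P) (hind : iIndepFun Y P) (hψ : MemLp ψ 2 ν)
    (hψ_mean : ∫ y, ψ y ∂ν = 0)
    (hZ : HasLaw Z (gaussianReal 0 (∫ y, ψ y ^ 2 ∂ν).toNNReal) Q) :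
    TendstoInDistribution (fun (n : ℕ) ω => (1 / √(n : ℝ)) * ∑ j : Fin n, ψ (Y j ω)) atTop Z
      (fun _ => P) Q := by
  have hψ_map : ∀ i, AEMeasurable ψ (P.map (Y i)) := fun i => by
    rw [(hY i).map_eq]
    exact hψ.1.aemeasurable
  have hmean : ∫ ω, ψ (Y 0 ω) ∂P = 0 := ((hY 0).integral_comp hψ.1).trans hψ_mean
  have hvar : Var[fun ω => ψ (Y 0 ω); P] = ∫ y, ψ y ^ 2 ∂ν := by
    refine (variance_of_integral_eq_zero ?_ hmean).trans ?_
    · exact (hψ_map 0).comp_aemeasurable (hY 0).aemeasurable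
    · exact (hY 0).integral_comp (f := fun y => ψ y ^ 2) (hψ.1.pow 2)
  have hclt := tendstoInDistribution_inv_sqrt_mul_sum_sub (X := fun i ω => ψ (Y i ω))
    (hvar ▸ hZ) (MemLp.comp_of_map (by rwa [(hY 0).map_eq]) (hY 0).aemeasurable)
    (hind.comp₀ (fun _ => ψ) (fun i => (hY i).aemeasurable) hψ_map)
    (fun i => ((hY i).identDistrib (hY 0)).comp_of_aemeasurable (hψ_map i))
  refine hclt.congr (fun n => ae_of_all _ fun ω => ?_) (ae_of_all _ fun _ => rfl)
  simp only [hmean, mul_zero, sub_zero, one_div, Fin.sum_univ_eq_sum_range fun j => ψ (Y j ω)]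

end Sample

section ScoreStatistic

variable {k m n : ℕ} {F : SignalFamily k} {H : ErrorFamily m}
  {p : (Fin k → ℝ) × (Fin m → ℝ)}

lemma normSum_apply (l : Fin n → Fin k → ℝ) (i : Fin k) :
    normSum l i = (1 / √(n : ℝ)) * ∑ j, l j i := by
  simp [normSum]

lemma measurable_normSum {l : (Fin n → ℝ) → Fin n → Fin k → ℝ} (hl : Measurable l) :
    Measurable fun y => normSum (l y) := by
  unfold normSum
  fun_prop

lemma measurable_scoreStat {l : (Fin n → ℝ) → Fin n → Fin k → ℝ}
    {L : (Fin n → ℝ) → Matrix (Fin k) (Fin k) ℝ} (hl : Measurable l)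
    (hL : ∀ i j, Measurable fun y => L y i j) : Measurable fun y => scoreStat (l y) (L y) := by
  have hsum := measurable_normSum hl
  simp only [scoreStat, dotProduct, mulVec]
  fun_prop

variable {Ω : Type*} [MeasurableSpace Ω] {P : Measure Ω} {Y : ℕ → Ω → ℝ}
  {l : (n : ℕ) → (Fin n → ℝ) → Fin n → Fin k → ℝ}
  {L : (n : ℕ) → (Fin n → ℝ) → Matrix (Fin k) (Fin k) ℝ}

lemma SufficientlyGoodAt.tendstoInMeasure_normSum_sub (h : SufficientlyGoodAt F H p l)
    (hlaw : ∀ n, HasLaw (fun ω (j : Fin n) => Y j ω) (Gn F H p n) P) (i : Fin k) :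
    TendstoInMeasure P (fun (n : ℕ) ω => normSum (l n fun j => Y j ω) i -
      normSum (fun j : Fin n => effScore F H p (Y j ω)) i) atTop 0 := by
  refine tendstoInMeasure_iff_norm.2 fun r hr => ?_
  refine tendsto_of_tendsto_of_tendsto_of_le_of_le tendsto_const_nhds (h r hr)
    (fun n => zero_le) fun n => ?_
  refine (measure_mono fun ω hω => ?_).trans (measure_preimage_le_of_hasLaw (hlaw n) _)
  set e : Fin k → ℝ := ∑ j, (l n (fun j => Y j ω) j - effScore F H p (Y j ω)) with he
  have hentry : normSum (l n fun j => Y j ω) i -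
      normSum (fun j : Fin n => effScore F H p (Y j ω)) i = (1 / √(n : ℝ)) * e i := by
    simp [normSum_apply, he, mul_sub]
  calc r ≤ ‖(1 / √(n : ℝ)) * e i‖ := by
        simpa only [← hentry, Pi.zero_apply, sub_zero, mem_ofPred_eq] using hω
    _ = (1 / √(n : ℝ)) * ‖e i‖ := by rw [norm_mul, Real.norm_of_nonneg (by positivity)]
    _ ≤ (1 / √(n : ℝ)) * ‖WithLp.toLp 2 e‖ := by
        gcongr
        exact PiLp.norm_apply_le (p := 2) (WithLp.toLp 2 e) i

lemma ConsistentAt.tendstoInMeasure (h : ConsistentAt F H p L)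
    (hlaw : ∀ n, HasLaw (fun ω (j : Fin n) => Y j ω) (Gn F H p n) P) (i j : Fin k) :
    TendstoInMeasure P (fun (n : ℕ) ω => L n (fun j => Y j ω) i j) atTop
      fun _ => (effFisher F H p)⁻¹ i j :=
  tendstoInMeasure_iff_norm.2 fun r hr =>
    tendsto_of_tendsto_of_tendsto_of_le_of_le tendsto_const_nhds (h i j r hr)
      (fun _ => zero_le) fun n => measure_preimage_le_of_hasLaw (hlaw n) _

variable [IsProbabilityMeasure P]

lemma IsRegular.tendstoInDistribution_normSum (hreg : IsRegular F H) (hp : p ∈ params F H)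
    (hl_meas : ∀ n, Measurable (l n)) (hl : SufficientlyGoodAt F H p l)
    (hY : ∀ i, HasLaw (Y i) (G F H p) P) (hind : iIndepFun Y P) (i : Fin k) {Ω' : Type*}
    [MeasurableSpace Ω'] {Q : Measure Ω'} [IsProbabilityMeasure Q] {Z : Ω' → ℝ}
    (hZ : HasLaw Z (gaussianReal 0 (effFisher F H p i i).toNNReal) Q) :
    TendstoInDistribution (fun n ω => normSum (l n fun j => Y j ω) i) atTop Z
      (fun _ => P) Q := by
  have hlaw := hasLaw_sample hY hind
  have hvar : effFisher F H p i i = ∫ y, effScore F H p y i ^ 2 ∂(G F H p) := by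
    simp [effFisher, sq]
  have hclt := tendstoInDistribution_sum_div_sqrt hY hind (hreg.memLp_effScore hp i)
    (hreg.integral_effScore hp i) (hvar ▸ hZ)
  simp_rw [← normSum_apply] at hclt
  exact tendstoInDistribution_of_tendstoInMeasure_sub _ _ hclt
    (hl.tendstoInMeasure_normSum_sub hlaw i) fun n =>
      (measurable_pi_apply i |>.comp (measurable_normSum (hl_meas n))).comp_aemeasurable
        (hlaw n).aemeasurable

lemma IsRegular.asymptoticallyTight_scoreStat (hreg : IsRegular F H) (hp : p ∈ params F H)
    (hl_meas : ∀ n, Measurable (l n)) (hL_meas : ∀ n i j, Measurable fun y => L n y i j)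
    (hl : SufficientlyGoodAt F H p l) (hL : ConsistentAt F H p L)
    (hY : ∀ i, HasLaw (Y i) (G F H p) P) (hind : iIndepFun Y P) :
    AsymptoticallyTight P atTop fun n ω =>
      scoreStat (l n fun j => Y j ω) (L n fun j => Y j ω) := by
  have hlaw := hasLaw_sample hY hind
  have hsum : AsymptoticallyTight P atTop fun n ω i => normSum (l n fun j => Y j ω) i :=
    .pi fun i => .of_tendstoInDistribution
      (hreg.tendstoInDistribution_normSum hp hl_meas hl hY hind i .id)
  have hmat : AsymptoticallyTight P atTop fun n ω i j => L n (fun j => Y j ω) i j :=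
    .pi fun i => .pi fun j => .of_tendstoInDistribution <|
      (hL.tendstoInMeasure hlaw i j).tendstoInDistribution fun n =>
        (hL_meas n i j).comp_aemeasurable (hlaw n).aemeasurable
  exact (hsum.prodMk hmat).continuous_comp
    (φ := fun q : (Fin k → ℝ) × (Fin k → Fin k → ℝ) => q.1 ⬝ᵥ (Matrix.of q.2 *ᵥ q.1))
    (by simp only [dotProduct, mulVec, of_apply]; fun_prop)

end ScoreStatistic

lemma hasLaw_mul_inv_mul_chiSquare_one {v : ℝ} (hv : 0 < v) :
    HasLaw (fun x : ℝ => x * (v⁻¹ * x)) (chiSquare 1) (gaussianReal 0 v.toNNReal) where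
  aemeasurable := by fun_prop
  map_eq := by
    have hscale : gaussianReal 0 v.toNNReal = (gaussianReal 0 1).map (√v * ·) := by
      rw [gaussianReal_map_const_mul, mul_zero, mul_one]
      congr 1
      exact NNReal.eq (by simp [Real.sq_sqrt hv.le, hv.le])
    have heval : gaussianReal 0 1 = (Measure.pi fun _ : Fin 1 => gaussianReal 0 1).map (· 0) :=
      (measurePreserving_eval (fun _ : Fin 1 => gaussianReal 0 1) 0).map_eq.symm
    rw [hscale, heval, Measure.map_map (by fun_prop) (by fun_prop),
      Measure.map_map (by fun_prop) (by fun_prop), chiSquare]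
    congr 1
    ext z
    have hsq : √v * √v = v := Real.mul_self_sqrt hv.le
    simp only [Function.comp_apply, Fin.sum_univ_one]
    field_simp
    linear_combination z 0 ^ 2 * hsq

lemma IsRegular.tendstoInDistribution_scoreStat_one {m : ℕ} {F : SignalFamily 1}
    {H : ErrorFamily m} {p : (Fin 1 → ℝ) × (Fin m → ℝ)} {Ω : Type*} [MeasurableSpace Ω]
    {P : Measure Ω} [IsProbabilityMeasure P] {Y : ℕ → Ω → ℝ}
    {l : (n : ℕ) → (Fin n → ℝ) → Fin n → Fin 1 → ℝ}
    {L : (n : ℕ) → (Fin n → ℝ) → Matrix (Fin 1) (Fin 1) ℝ}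
    (hreg : IsRegular F H) (hp : p ∈ params F H)
    (hl_meas : ∀ n, Measurable (l n)) (hL_meas : ∀ n i j, Measurable fun y => L n y i j)
    (hl : SufficientlyGoodAt F H p l) (hL : ConsistentAt F H p L)
    (hY : ∀ i, HasLaw (Y i) (G F H p) P) (hind : iIndepFun Y P) :
    TendstoInDistribution
      (fun n ω => scoreStat (l n fun j => Y j ω) (L n fun j => Y j ω)) atTop id
      (fun _ => P) (chiSquare 1) := by
  have hlaw := hasLaw_sample hY hind
  have hpos : 0 < effFisher F H p 0 0 := (hreg.posDef_effFisher hp).diag_pos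
  have hinv : (effFisher F H p)⁻¹ 0 0 = (effFisher F H p 0 0)⁻¹ := by
    simp [Matrix.inv_subsingleton]
  have hslutsky := (hreg.tendstoInDistribution_normSum hp hl_meas hl hY hind 0
      .id).continuous_comp_prodMk_of_tendstoInMeasure_const
    (g := fun x : ℝ × ℝ => x.1 * (x.2 * x.1)) (by fun_prop) (hL.tendstoInMeasure hlaw 0 0)
    fun n => (hL_meas n 0 0).comp_aemeasurable (hlaw n).aemeasurable
  rw [hinv] at hslutsky
  refine tendstoInDistribution_id_of_hasLaw (hslutsky.congr (fun n => ae_of_all _ fun ω => ?_)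
    (ae_of_all _ fun _ => rfl)) (hasLaw_mul_inv_mul_chiSquare_one hpos)
  simp [scoreStat, mulVec, dotProduct]

section Selection

variable {d : ℕ}

lemma exists_penalized_max (hd : 1 ≤ d) (w c : ℕ → ℝ) :
    ∃ k, 1 ≤ k ∧ k ≤ d ∧ ∀ j, 1 ≤ j → j ≤ d → w j - c j ≤ w k - c k := by
  simpa [and_assoc] using
    (Finset.Icc 1 d).exists_max_image (fun k => w k - c k) (Finset.nonempty_Icc.2 hd)

lemma selectionRule_spec (hd : 1 ≤ d) (w c : ℕ → ℝ) :
    1 ≤ selectionRule d w c ∧ selectionRule d w c ≤ d ∧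
      ∀ j, 1 ≤ j → j ≤ d → w j - c j ≤ w (selectionRule d w c) - c (selectionRule d w c) :=
  Nat.sInf_mem (exists_penalized_max hd w c)

lemma selectionRule_congr {w w' : ℕ → ℝ} (c : ℕ → ℝ) (h : ∀ k, 1 ≤ k → k ≤ d → w k = w' k) :
    selectionRule d w c = selectionRule d w' c := by
  refine congrArg sInf (ext fun k => and_congr_right fun h1 => and_congr_right fun hd =>
    forall₃_congr fun j hj1 hjd => ?_)
  rw [h k h1 hd, h j hj1 hjd]

lemma measurable_selectionRule (hd : 1 ≤ d) (c : ℕ → ℝ) :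
    Measurable fun w : ℕ → ℝ => selectionRule d w c := by
  classical
  have hfind : (fun w : ℕ → ℝ => selectionRule d w c) =
      fun w => Nat.find (exists_penalized_max hd w c) :=
    funext fun w => le_antisymm (Nat.sInf_le (Nat.find_spec (exists_penalized_max hd w c)))
      (Nat.find_min' _ (selectionRule_spec hd w c))
  rw [hfind]
  refine measurable_find _ fun k => measurableSet_setOfPred.2 ?_
  refine measurable_const.and (measurable_const.and (.forall fun j =>
    measurable_const.imp (measurable_const.imp (measurableSet_setOfPred.1 ?_))))
  exact measurableSet_le (by fun_prop) (by fun_prop)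

lemma measurable_apply_selectionRule (hd : 1 ≤ d) (c : ℕ → ℝ) :
    Measurable fun w : ℕ → ℝ => w (selectionRule d w c) := by
  have heval : Measurable fun x : ℕ × (ℕ → ℝ) => x.2 x.1 :=
    measurable_from_prod_countable_right measurable_pi_apply
  exact heval.comp ((measurable_selectionRule hd c).prodMk measurable_id)

variable {ι Ω : Type*} [MeasurableSpace Ω] {P : Measure Ω}

lemma aemeasurable_apply_selectionRule (hd : 1 ≤ d) (c : ℕ → ℝ) {w : ℕ → Ω → ℝ}
    (hw : ∀ k, 1 ≤ k → k ≤ d → AEMeasurable (w k) P) :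
    AEMeasurable (fun ω => w (selectionRule d (fun k => w k ω) c) ω) P := by
  classical
  -- Only the statistics with index in `1, …, d` are measurable, so the others are replaced by `0`.
  set w₀ : Ω → ℕ → ℝ := fun ω k => if 1 ≤ k ∧ k ≤ d then w k ω else 0 with hw₀
  have hw₀_meas : AEMeasurable w₀ P := by
    refine aemeasurable_pi_lambda _ fun k => ?_
    by_cases hk : 1 ≤ k ∧ k ≤ d
    · simpa only [hw₀, if_pos hk] using hw k hk.1 hk.2
    · simpa only [hw₀, if_neg hk] using aemeasurable_const
  have hw₀_eq : ∀ ω k, 1 ≤ k → k ≤ d → w₀ ω k = w k ω := fun ω k h1 hkd => if_pos ⟨h1, hkd⟩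
  refine ((measurable_apply_selectionRule hd c).comp_aemeasurable hw₀_meas).congr
    (ae_of_all _ fun ω => ?_)
  obtain ⟨h1, hSd, -⟩ := selectionRule_spec hd (fun k => w k ω) c
  rw [Function.comp_apply, selectionRule_congr c (hw₀_eq ω), hw₀_eq ω _ h1 hSd]

lemma exists_sub_le_sub_of_one_lt_selectionRule (hd : 1 ≤ d) {w c : ℕ → ℝ}
    (h : 1 < selectionRule d w c) : ∃ k ∈ Finset.Icc 2 d, c k - c 1 ≤ w k - w 1 := by
  obtain ⟨-, hSd, hmax⟩ := selectionRule_spec hd w c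
  exact ⟨_, Finset.mem_Icc.2 ⟨h, hSd⟩, by linarith [hmax 1 le_rfl hd]⟩

variable {u : Filter ι} {w : ℕ → ι → Ω → ℝ} {c : ℕ → ι → ℝ}

theorem tendsto_measure_one_lt_selectionRule (hd : 1 ≤ d)
    (hw : ∀ k, 1 ≤ k → k ≤ d → AsymptoticallyTight P u (w k))
    (hc : ∀ k, 2 ≤ k → k ≤ d → Tendsto (fun i => c k i - c 1 i) u atTop) :
    Tendsto (fun i => P {ω | 1 < selectionRule d (fun k => w k i ω) fun k => c k i})
      u (𝓝 0) := by
  have hsum : Tendsto (fun i => ∑ k ∈ Finset.Icc 2 d, P {ω | c k i - c 1 i ≤ w k i ω - w 1 i ω})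
      u (𝓝 0) := by
    rw [← Finset.sum_const_zero (s := Finset.Icc 2 d)]
    refine tendsto_finsetSum _ fun k hk => ?_
    obtain ⟨hk2, hkd⟩ := Finset.mem_Icc.1 hk
    have htight : AsymptoticallyTight P u fun i ω => w k i ω - w 1 i ω :=
      ((hw k (by lia) hkd).prodMk (hw 1 le_rfl hd)).continuous_comp continuous_sub
    exact htight.tendsto_measure_ge (hc k hk2 hkd)
  refine tendsto_of_tendsto_of_tendsto_of_le_of_le tendsto_const_nhds hsum
    (fun i => zero_le) fun i => ?_
  refine (measure_mono fun ω hω => ?_).trans (measure_biUnion_finset_le _ _)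
  obtain ⟨k, hk, hle⟩ := exists_sub_le_sub_of_one_lt_selectionRule hd hω
  exact mem_biUnion hk hle

theorem tendstoInDistribution_apply_selectionRule [IsProbabilityMeasure P]
    [u.IsCountablyGenerated] (hd : 1 ≤ d)
    (hw_meas : ∀ k, 1 ≤ k → k ≤ d → ∀ i, AEMeasurable (w k i) P) {Ω' : Type*} [MeasurableSpace Ω']
    {Q : Measure Ω'} [IsProbabilityMeasure Q] {Z : Ω' → ℝ}
    (hw_one : TendstoInDistribution (w 1) u Z (fun _ => P) Q)
    (hsel : Tendsto (fun i => P {ω | 1 < selectionRule d (fun k => w k i ω) fun k => c k i})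
      u (𝓝 0)) :
    TendstoInDistribution
      (fun i ω => w (selectionRule d (fun k => w k i ω) fun k => c k i) i ω) u Z
      (fun _ => P) Q := by
  refine tendstoInDistribution_of_tendsto_measure_ne hw_one
    (fun i => aemeasurable_apply_selectionRule (w := fun k => w k i) hd _
      fun k h1 hkd => hw_meas k h1 hkd i) ?_
  refine tendsto_of_tendsto_of_tendsto_of_le_of_le tendsto_const_nhds hsel
    (fun i => zero_le) fun i => measure_mono fun ω hne => ?_
  refine (selectionRule_spec hd _ _).1.lt_of_ne fun heq => hne ?_
  rw [← heq]

end Selection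

end Deconv

theorem mainTheorem6_general {d m : ℕ} (hd : 1 ≤ d)
    (F : (k : ℕ) → Deconv.SignalFamily k) (H : Deconv.ErrorFamily m)
    (hreg : ∀ k, 1 ≤ k → k ≤ d → Deconv.IsRegular (F k) H)
    (p : (k : ℕ) → (Fin k → ℝ) × (Fin m → ℝ))
    (hp : ∀ k, 1 ≤ k → k ≤ d → p k ∈ Deconv.params (F k) H)
    (l : (k n : ℕ) → (Fin n → ℝ) → Fin n → Fin k → ℝ)
    (L : (k n : ℕ) → (Fin n → ℝ) → Matrix (Fin k) (Fin k) ℝ)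
    (hl_meas : ∀ k, 1 ≤ k → k ≤ d → ∀ n, Measurable (l k n))
    (hL_meas : ∀ k, 1 ≤ k → k ≤ d → ∀ n i j, Measurable (fun y => L k n y i j))
    (hl : ∀ k, 1 ≤ k → k ≤ d → Deconv.SufficientlyGoodAt (F k) H (p k) (l k))
    (hL : ∀ k, 1 ≤ k → k ≤ d → Deconv.ConsistentAt (F k) H (p k) (L k))
    (pen : ℕ → ℕ → ℝ)
    (hpen : ∀ j, 2 ≤ j → j ≤ d → Tendsto (fun n => pen j n - pen 1 n) atTop atTop)
    {Ω : Type*} [MeasurableSpace Ω] (P : Measure Ω) [IsProbabilityMeasure P] (Y : ℕ → Ω → ℝ)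
    (hY : ∀ k, 1 ≤ k → k ≤ d → ∀ i, HasLaw (Y i) (Deconv.G (F k) H (p k)) P)
    (hind : iIndepFun Y P) (W : (k n : ℕ) → Ω → ℝ)
    (hW : ∀ k n ω, W k n ω =
      Deconv.scoreStat (l k n (fun j => Y j ω)) (L k n (fun j => Y j ω)))
    (S : ℕ → Ω → ℕ)
    (hS : ∀ n ω, S n ω = Deconv.selectionRule d (fun k => W k n ω) (fun k => pen k n)) :
    Tendsto (fun n => P {ω | 1 < S n ω}) atTop (𝓝 0) ∧
      TendstoInDistribution (fun n ω => W (S n ω) n ω) atTop id (fun _ => P)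
        (Deconv.chiSquare 1) := by
  obtain rfl : S = _ := funext₂ hS
  have hW_eq : ∀ k, W k = fun n ω =>
      Deconv.scoreStat (l k n fun j => Y j ω) (L k n fun j => Y j ω) := fun k => funext₂ (hW k)
  have hW_meas : ∀ k, 1 ≤ k → k ≤ d → ∀ n, AEMeasurable (W k n) P := fun k h1 hk n => by
    rw [hW_eq]
    exact (Deconv.measurable_scoreStat (hl_meas k h1 hk n) (hL_meas k h1 hk n)).comp_aemeasurable
      (Deconv.hasLaw_sample (hY k h1 hk) hind n).aemeasurable
  have hW_tight : ∀ k, 1 ≤ k → k ≤ d → Deconv.AsymptoticallyTight P atTop (W k) :=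
    fun k h1 hk => hW_eq k ▸ (hreg k h1 hk).asymptoticallyTight_scoreStat (hp k h1 hk)
      (hl_meas k h1 hk) (hL_meas k h1 hk) (hl k h1 hk) (hL k h1 hk) (hY k h1 hk) hind
  have hW_one : TendstoInDistribution (W 1) atTop id (fun _ => P) (Deconv.chiSquare 1) :=
    hW_eq 1 ▸ (hreg 1 le_rfl hd).tendstoInDistribution_scoreStat_one (hp 1 le_rfl hd)
      (hl_meas 1 le_rfl hd) (hL_meas 1 le_rfl hd) (hl 1 le_rfl hd) (hL 1 le_rfl hd)
      (hY 1 le_rfl hd) hind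
  have hsel := Deconv.tendsto_measure_one_lt_selectionRule hd hW_tight hpen
  exact ⟨hsel, Deconv.tendstoInDistribution_apply_selectionRule hd hW_meas hW_one hsel⟩

theorem mainTheorem6 {d m : ℕ} (hd : 1 ≤ d)
    -- the nested family of submodels and the common family of error densities
    (F : (k : ℕ) → Deconv.SignalFamily k) (H : Deconv.ErrorFamily m)
    (hnested : Deconv.IsNested d F)
    (hreg : ∀ k, 1 ≤ k → k ≤ d → Deconv.IsRegular (F k) H)
    -- the null hypothesis: the signal density is `f₀`, at the parameter `θ₀ k` of the `k`-th model
    (f₀ : ℝ → ℝ) (θ₀ : (k : ℕ) → Fin k → ℝ)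
    (hθ₀ : ∀ k, 1 ≤ k → k ≤ d → θ₀ k ∈ (F k).Θ ∧ (F k).f (θ₀ k) = f₀)
    -- the true value of the nuisance parameter
    (η₀ : Fin m → ℝ) (hη₀ : η₀ ∈ H.Λ)
    -- the estimated efficient scores and the estimated inverse efficient information
    (l : (k n : ℕ) → (Fin n → ℝ) → Fin n → Fin k → ℝ)
    (L : (k n : ℕ) → (Fin n → ℝ) → Matrix (Fin k) (Fin k) ℝ)
    (hl_meas : ∀ k, 1 ≤ k → k ≤ d → ∀ n, Measurable (l k n))
    (hL_meas : ∀ k, 1 ≤ k → k ≤ d → ∀ n i j, Measurable (fun y => L k n y i j))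
    (hl : ∀ k, 1 ≤ k → k ≤ d → Deconv.SufficientlyGoodAt (F k) H (θ₀ k, η₀) (l k))
    (hL : ∀ k, 1 ≤ k → k ≤ d → Deconv.ConsistentAt (F k) H (θ₀ k, η₀) (L k))
    -- the penalty
    (pen : ℕ → ℕ → ℝ) (hpen : Deconv.IsPenalty d pen)
    -- the signals `X i`, the errors `ε i` and the observations `Y i = X i + ε i`
    {Ω : Type*} [MeasurableSpace Ω] (P : Measure Ω) [IsProbabilityMeasure P]
    (X ε Y : ℕ → Ω → ℝ)
    (hX : ∀ i, HasLaw (X i) (Deconv.lawOf f₀) P)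
    (hε : ∀ i, HasLaw (ε i) (Deconv.lawOf (H.h η₀)) P)
    (hXε : ∀ i, IndepFun (X i) (ε i) P)
    (hindep : iIndepFun (fun i ω => (X i ω, ε i ω)) P)
    (hY : ∀ i ω, Y i ω = X i ω + ε i ω)
    -- the test statistics `W k n` and the selection rule `S n`
    (W : (k n : ℕ) → Ω → ℝ)
    (hW : ∀ k n ω, W k n ω =
      Deconv.scoreStat (l k n (fun j => Y j ω)) (L k n (fun j => Y j ω)))
    (S : ℕ → Ω → ℕ)
    (hS : ∀ n ω, S n ω = Deconv.selectionRule d (fun k => W k n ω) (fun k => pen k n)) :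
    Tendsto (fun n => P {ω | 1 < S n ω}) atTop (𝓝 0) ∧
      TendstoInDistribution (fun n ω => W (S n ω) n ω) atTop id (fun _ => P)
        (Deconv.chiSquare 1) := by
  obtain rfl : Y = fun i => X i + ε i := funext₂ hY
  have hp k h1 hk : (θ₀ k, η₀) ∈ Deconv.params (F k) H := ⟨(hθ₀ k h1 hk).1, hη₀⟩
  exact mainTheorem6_general hd F H hreg (fun k => (θ₀ k, η₀)) hp l L hl_meas hL_meas hl hL pen
    hpen.tendsto P _ (fun k h1 hk i => Deconv.hasLaw_add_G (hp k h1 hk)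
      ((hθ₀ k h1 hk).2 ▸ hX i) (hε i) (hXε i))
    (hindep.comp (fun _ x => x.1 + x.2) fun _ => by fun_prop) W hW S hS
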